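/- For nonempty sets $X,Y$ and partial functions $f,g$ from $X$ to $Y$, the override $f\sqcup g$ is the partial function that takes the value $f(x)$ where $f$ is defined, the value $g(x)$ where $g$ is defined and $f$ is not, and is undefined elsewhere. Let $\operatorname{Rep}(\sqcup)$ be the class of algebras with one binary operation that are isomorphic to a set of partial functions (for some nonempty $X,Y$) closed under $\sqcup$, with the operation $\sqcup$. Let $\mathbf L=\{0,+,-\}$ be the three-element monoid with identity $0$ in which $(+)\cdot a=+$ and $(-)\cdot a=-$ for all $a$. The quasivariety generated by $\mathbf L$ is the class of all algebras with one binary operation that satisfy every quasi-identity (a universally quantified implication from a finite conjunction of equations to an equation) that holds in $\mathbf L$. For a finite set $\mathcal H$ of linear hyperplanes (subspaces of dimension $n-1$) in $\mathbb R^n$, the faces are the nonempty classes of points of $\mathbb R^n$ that, for each $H\in\mathcal H$, lie all on $H$ or all strictly on the same side of $H$. The product $F\cdot G$ of two faces is the face reached from any point of $F$ by travelling any sufficiently small positive distance in a straight line towards any point of $G$. A hyperplane face semigroup is a set of faces, for some $n$ and $\mathcal H$, closed under this product. Let $\Sigma_{\mathbf L}$ consist of the laws $x(yz)=(xy)z$,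 $xx=x$, $xyx=xy$ together with, for every integer $n\ge 1$, the quasi-identity $\lambda_n$ in the variables $x,y,z_1,\dots,z_{2n+1}$: $$\left.\begin{array}{l} xy=x,\quad yx=y,\quad z_1x=x,\quad z_{2n+1}y=y,\\ z_ix=z_iy\quad(1\le i\le 2n+1),\\ z_{2i-1}z_{2i}=z_{2i},\quad z_{2i+1}z_{2i}=z_{2i}\quad(1\le i\le n)\end{array}\right\}\ \longrightarrow\ x=y .$$ Corollary 3.1. 1. $\operatorname{Rep}(\sqcup)$ is precisely the class of semigroups in the quasivariety generated by $\mathbf L$. 2. The finite members of $\operatorname{Rep}(\sqcup)$ are precisely the semigroups isomorphic to hyperplane face semigroups. 3. $\operatorname{Rep}(\sqcup)$ is precisely the class of models of $\Sigma_{\mathbf L}$. 4. No finite set of first-order sentences in the language of one binary operation has $\operatorname{Rep}(\sqcup)$ as its class of models; this holds even if only algebras with nonempty underlying set are considered. -/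

import Mathlib

universe u

open FirstOrder Filter Topology

noncomputable section

namespace Override

/-! ### Partial functions and override -/

/-- The override `f ⊔ g` of partial functions: `f x` where `f` is defined, otherwise `g x`
(which is undefined when `g` is undefined at `x`). -/
def override {X Y : Type*} (f g : X →. Y) : X →. Y :=
  open Classical in fun x => if (f x).Dom then f x else g x

/-- `S`, with its binary operation, is isomorphic to an algebra of partial functions under override:
it embeds into the algebra of all partial functions from `X` to `Y`, for some nonempty sets
`X` and `Y`. -/
def IsRepresentable (S : Type u) [Mul S] : Prop :=
  ∃ (X Y : Type u) (_ : Nonempty X) (_ : Nonempty Y) (f : S → (X →. Y)),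
    Function.Injective f ∧ ∀ a b : S, f (a * b) = override (f a) (f b)

/-! ### The three-element monoid -/

/-- The three-element monoid whose identity is `zero` and in which `plus` and `minus` are
left zeros. -/
inductive L : Type
  | zero
  | plus
  | minus

instance : Monoid L where
  mul
    | L.zero, b => b
    | L.plus, _ => L.plus
    | L.minus, _ => L.minus
  mul_assoc a b c := by cases a <;> rfl
  one := L.zero
  one_mul _ := rfl
  mul_one a := by cases a <;> rfl

/-! ### First-order logic of one binary operation, quasi-identities -/

inductive MagmaFunctions : ℕ → Type
  | mul : MagmaFunctions 2

/-- The first-order language with one binary operation symbol and nothing else. -/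
def magmaLang : FirstOrder.Language.{0, 0} :=
  ⟨MagmaFunctions, fun _ => Empty⟩

/-- A set with a binary operation as a structure of the first-order language. -/
instance magmaStructure (S : Type*) [Mul S] : magmaLang.Structure S where
  funMap | MagmaFunctions.mul, v => v 0 * v 1
  RelMap r _ := r.elim

/-- The formal product of two terms. -/
instance {α : Type*} : Mul (magmaLang.Term α) where
  mul s t := Language.Functions.apply₂ (L := magmaLang) MagmaFunctions.mul s t

theorem realize_mul {S : Type*} [Mul S] {α : Type*} (v : α → S) (s t : magmaLang.Term α) :
    (s * t).realize v = s.realize v * t.realize v := rfl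

/-- A quasi-identity in `k` variables: finitely many equations between terms (the premises) and
one further equation (the conclusion). -/
structure QuasiIdentity where
  k : ℕ
  premises : List (magmaLang.Term (Fin k) × magmaLang.Term (Fin k))
  conclusion : magmaLang.Term (Fin k) × magmaLang.Term (Fin k)

/-- The equation between two terms as a formula whose `k` variables are still to be quantified. -/
def equation {k : ℕ} (e : magmaLang.Term (Fin k) × magmaLang.Term (Fin k)) :
    magmaLang.BoundedFormula Empty k :=
  (e.1.relabel Sum.inr).bdEqual (e.2.relabel Sum.inr)

/-- The quasi-identity as a universally quantified first-order sentence. -/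
def QuasiIdentity.toSentence (q : QuasiIdentity) : magmaLang.Sentence :=
  (((q.premises.map equation).foldr (· ⊓ ·) ⊤).imp (equation q.conclusion)).alls

theorem realize_equation {S : Type*} [Mul S] {k : ℕ}
    (e : magmaLang.Term (Fin k) × magmaLang.Term (Fin k)) (w : Empty → S) (v : Fin k → S) :
    (equation e).Realize w v ↔ e.1.realize v = e.2.realize v := by
  simp [equation, Language.Term.realize_relabel]

theorem QuasiIdentity.realize_toSentence {S : Type*} [Mul S] (q : QuasiIdentity) :
    S ⊨ q.toSentence ↔ ∀ v : Fin q.k → S,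
      (∀ e ∈ q.premises, e.1.realize v = e.2.realize v) →
        q.conclusion.1.realize v = q.conclusion.2.realize v := by
  unfold Language.Sentence.Realize Language.Formula.Realize
  rw [QuasiIdentity.toSentence]
  refine Language.BoundedFormula.realize_alls.trans (forall_congr' fun v => ?_)
  rw [Language.BoundedFormula.realize_imp, Language.BoundedFormula.realize_foldr_inf,
    realize_equation]
  refine imp_congr_left ⟨fun h e he => ?_, fun h φ hφ => ?_⟩
  · exact (realize_equation e _ v).1 (h _ (List.mem_map_of_mem he))
  · obtain ⟨e, he, rfl⟩ := List.mem_map.1 hφ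
    exact (realize_equation e _ v).2 (h e he)

/-- `S` belongs to the quasivariety generated by `A`, the smallest class that contains `A` and is
defined by quasi-identities: `S` satisfies every quasi-identity that holds in `A`. -/
def InQuasivarietyOf (A : Type*) [Mul A] (S : Type*) [Mul S] : Prop :=
  ∀ q : QuasiIdentity, A ⊨ q.toSentence → S ⊨ q.toSentence

/-! ### The axiom system -/

/-- `x (y z) = (x y) z` -/
def assocLaw : QuasiIdentity :=
  let x : magmaLang.Term (Fin 3) := .var 0
  let y : magmaLang.Term (Fin 3) := .var 1
  let z : magmaLang.Term (Fin 3) := .var 2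
  ⟨3, [], (x * (y * z), (x * y) * z)⟩

/-- `x x = x` -/
def idemLaw : QuasiIdentity :=
  let x : magmaLang.Term (Fin 1) := .var 0
  ⟨1, [], (x * x, x)⟩

/-- `x y x = x y` -/
def leftRegularLaw : QuasiIdentity :=
  let x : magmaLang.Term (Fin 2) := .var 0
  let y : magmaLang.Term (Fin 2) := .var 1
  ⟨2, [], ((x * y) * x, x * y)⟩

/-- The variable `z i`, for `1 ≤ i ≤ 2 * n + 1`, among the `2 * n + 3` variables
`x, y, z 1, …, z (2 * n + 1)`. -/
def zVar (n i : ℕ) : magmaLang.Term (Fin (2 * n + 3)) :=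
  .var (Fin.ofNat (2 * n + 3) (i + 1))

/-- The premises of `lam n`, where `1 ≤ i ≤ 2 * n + 1` in the first family and `1 ≤ i ≤ n` in the
other two. -/
def lamPremises (n : ℕ) :
    List (magmaLang.Term (Fin (2 * n + 3)) × magmaLang.Term (Fin (2 * n + 3))) :=
  let x : magmaLang.Term (Fin (2 * n + 3)) := .var 0
  let y : magmaLang.Term (Fin (2 * n + 3)) := .var 1
  let z := zVar n
  [(x * y, x), (y * x, y), (z 1 * x, x), (z (2 * n + 1) * y, y)]
    ++ (List.Ico 1 (2 * n + 2)).map (fun i => (z i * x, z i * y))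
    ++ (List.Ico 1 (n + 1)).map (fun i => (z (2 * i - 1) * z (2 * i), z (2 * i)))
    ++ (List.Ico 1 (n + 1)).map (fun i => (z (2 * i + 1) * z (2 * i), z (2 * i)))

/-- The quasi-identity `lam n` in the variables `x, y, z 1, …, z (2 * n + 1)`, with conclusion
`x = y`; it is written out in `realize_lam` below. -/
def lam (n : ℕ) : QuasiIdentity :=
  ⟨2 * n + 3, lamPremises n, (.var 0, .var 1)⟩

/-- The axiom system as a first-order theory: the three laws of left regular bands together with
`lam n` for all `n ≥ 1`. -/
def sigmaL : magmaLang.Theory :=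
  {assocLaw.toSentence, idemLaw.toSentence, leftRegularLaw.toSentence} ∪
    {φ | ∃ n : ℕ, 1 ≤ n ∧ φ = (lam n).toSentence}

theorem realize_assocLaw {S : Type*} [Mul S] :
    S ⊨ assocLaw.toSentence ↔ ∀ x y z : S, x * (y * z) = (x * y) * z := by
  rw [QuasiIdentity.realize_toSentence]
  refine ⟨fun h x y z => ?_, fun h v _ => h (v (0 : Fin 3)) (v (1 : Fin 3)) (v (2 : Fin 3))⟩
  exact h ![x, y, z] (fun e he => absurd he List.not_mem_nil)

theorem realize_idemLaw {S : Type*} [Mul S] :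
    S ⊨ idemLaw.toSentence ↔ ∀ x : S, x * x = x := by
  rw [QuasiIdentity.realize_toSentence]
  refine ⟨fun h x => ?_, fun h v _ => h (v (0 : Fin 1))⟩
  exact h (fun _ => x) (fun e he => absurd he List.not_mem_nil)

theorem realize_leftRegularLaw {S : Type*} [Mul S] :
    S ⊨ leftRegularLaw.toSentence ↔ ∀ x y : S, (x * y) * x = x * y := by
  rw [QuasiIdentity.realize_toSentence]
  refine ⟨fun h x y => ?_, fun h v _ => h (v (0 : Fin 2)) (v (1 : Fin 2))⟩
  exact h ![x, y] (fun e he => absurd he List.not_mem_nil)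

theorem realize_lam {S : Type*} [Mul S] (n : ℕ) :
    S ⊨ (lam n).toSentence ↔ ∀ (x y : S) (z : ℕ → S),
      x * y = x → y * x = y → z 1 * x = x → z (2 * n + 1) * y = y →
      (∀ i, 1 ≤ i → i ≤ 2 * n + 1 → z i * x = z i * y) →
      (∀ i, 1 ≤ i → i ≤ n →
        z (2 * i - 1) * z (2 * i) = z (2 * i) ∧ z (2 * i + 1) * z (2 * i) = z (2 * i)) →
      x = y := by
  rw [QuasiIdentity.realize_toSentence]
  change (∀ v : Fin (2 * n + 3) → S,
    (∀ e ∈ lamPremises n, e.1.realize v = e.2.realize v) → v 0 = v 1) ↔ _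
  simp only [lamPremises, List.mem_append, List.mem_cons, List.mem_map, List.Ico.mem,
    List.not_mem_nil, or_false, zVar]
  constructor
  · intro h x y z h1 h2 h3 h4 h5 h6
    let v : Fin (2 * n + 3) → S := fun k =>
      if k.val = 0 then x else if k.val = 1 then y else z (k.val - 1)
    have hv0 : v 0 = x := by simp [v]
    have hv1 : v 1 = y := by simp [v]
    have hvz : ∀ i, 1 ≤ i → i ≤ 2 * n + 1 → v (Fin.ofNat (2 * n + 3) (i + 1)) = z i := by
      intro i hi hi'
      have : (Fin.ofNat (2 * n + 3) (i + 1)).val = i + 1 := Nat.mod_eq_of_lt (by omega)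
      simp only [v, this]
      rw [if_neg (by omega), if_neg (by omega)]
      simp
    have key := h v
    simp only [hv0, hv1] at key
    apply key
    rintro e (((he | ⟨i, hi, rfl⟩) | ⟨i, hi, rfl⟩) | ⟨i, hi, rfl⟩)
    · rcases he with rfl | rfl | rfl | rfl <;>
        simp only [realize_mul, FirstOrder.Language.Term.realize_var, hv0, hv1]
      · exact h1
      · exact h2
      · rwa [hvz 1 (by omega) (by omega)]
      · rwa [hvz _ (by omega) (by omega)]
    · simp only [realize_mul, FirstOrder.Language.Term.realize_var, hv0, hv1]
      rw [hvz i (by omega) (by omega)]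
      exact h5 i (by omega) (by omega)
    · simp only [realize_mul, FirstOrder.Language.Term.realize_var]
      rw [hvz _ (by omega) (by omega), hvz _ (by omega) (by omega)]
      exact (h6 i (by omega) (by omega)).1
    · simp only [realize_mul, FirstOrder.Language.Term.realize_var]
      rw [hvz _ (by omega) (by omega), hvz _ (by omega) (by omega)]
      exact (h6 i (by omega) (by omega)).2
  · intro h v hv
    refine h (v 0) (v 1) (fun i => v (Fin.ofNat (2 * n + 3) (i + 1)))
      (hv _ (.inl (.inl (.inl (.inl rfl))))) (hv _ (.inl (.inl (.inl (.inr (.inl rfl))))))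
      (hv _ (.inl (.inl (.inl (.inr (.inr (.inl rfl)))))))
      (hv _ (.inl (.inl (.inl (.inr (.inr (.inr rfl)))))))
      (fun i hi hi' => hv _ (.inl (.inl (.inr ⟨i, by omega, rfl⟩))))
      (fun i hi hi' => ⟨hv _ (.inl (.inr ⟨i, by omega, rfl⟩)), hv _ (.inr ⟨i, by omega, rfl⟩)⟩)

/-! ### Hyperplane faces -/

/-- A finite set of linear hyperplanes, that is, subspaces of dimension `n - 1`, in `ℝⁿ`. -/
structure Arrangement (n : ℕ) where
  planes : Finset (Submodule ℝ (EuclideanSpace ℝ (Fin n)))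
  finrank_add_one : ∀ H ∈ planes, Module.finrank ℝ H + 1 = n

variable {n : ℕ}

/-- Two points lie in the same region when, for each hyperplane, either both are on it or both are
strictly on the same side of it. -/
def SameRegion (𝓗 : Arrangement n) (p q : EuclideanSpace ℝ (Fin n)) : Prop :=
  ∀ H ∈ 𝓗.planes, (p ∈ H ∧ q ∈ H) ∨ H.toAffineSubspace.SSameSide p q

/-- The faces of the arrangement: the (nonempty) regions into which it partitions `ℝⁿ`. -/
def Face (𝓗 : Arrangement n) : Type :=
  {F : Set (EuclideanSpace ℝ (Fin n)) // ∃ p, F = {q | SameRegion 𝓗 p q}}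

/-- The points of the region reached from any point `p` of `F` by travelling any sufficiently
small positive distance in a straight line towards any point `q` of `G`. -/
def reached (𝓗 : Arrangement n) (F G : Set (EuclideanSpace ℝ (Fin n))) :
    Set (EuclideanSpace ℝ (Fin n)) :=
  {r | ∀ p ∈ F, ∀ q ∈ G, ∀ᶠ t : ℝ in 𝓝[>] 0, SameRegion 𝓗 r (AffineMap.lineMap p q t)}

/-- For a hyperplane `H`, given as the kernel of a linear functional, lying on `H` together or
strictly on the same side of it means that the functional has the same sign. -/
theorem sameSide_iff_sign {E : Type*} [AddCommGroup E] [Module ℝ E] (f : E →ₗ[ℝ] ℝ) (p q : E) :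
    ((p ∈ LinearMap.ker f ∧ q ∈ LinearMap.ker f) ∨
      (LinearMap.ker f).toAffineSubspace.SSameSide p q) ↔
      SignType.sign (f p) = SignType.sign (f q) := by
  simp only [AffineSubspace.SSameSide, AffineSubspace.WSameSide, Submodule.mem_toAffineSubspace,
    LinearMap.mem_ker, vsub_eq_sub]
  constructor
  · rintro (⟨h1, h2⟩ | ⟨⟨a, ha, b, hb, hab⟩, hp, hq⟩)
    · rw [h1, h2]
    · have h := hab.map f
      rw [map_sub, map_sub, ha, hb, sub_zero, sub_zero] at h
      obtain ⟨r, s, hr, hs, h⟩ := h.exists_pos hp hq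
      have h1 : SignType.sign (r • f p) = SignType.sign (f p) := by
        rw [smul_eq_mul, sign_mul, sign_pos hr, one_mul]
      have h2 : SignType.sign (s • f q) = SignType.sign (f q) := by
        rw [smul_eq_mul, sign_mul, sign_pos hs, one_mul]
      rw [← h1, ← h2, h]
  · intro h
    by_cases hp : f p = 0
    · refine .inl ⟨hp, ?_⟩
      rw [hp, sign_zero] at h
      exact sign_eq_zero_iff.1 h.symm
    · have hq : f q ≠ 0 := by
        intro hq
        rw [hq, sign_zero] at h
        exact hp (sign_eq_zero_iff.1 h)
      refine .inr ⟨⟨0, map_zero f, q - (f q / f p) • p, ?_, ?_⟩, hp, hq⟩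
      · rw [map_sub, map_smul, smul_eq_mul, div_mul_cancel₀ _ hp, sub_self]
      · rw [sub_zero, sub_sub_cancel]
        refine SameRay.sameRay_nonneg_smul_right p ?_
        rcases lt_or_gt_of_ne hp with hp' | hp'
        · rw [sign_neg hp'] at h
          exact div_nonneg_of_nonpos (sign_eq_neg_one_iff.1 h.symm).le hp'.le
        · rw [sign_pos hp'] at h
          exact div_nonneg (sign_eq_one_iff.1 h.symm).le hp'.le

theorem exists_functionals (𝓗 : Arrangement n) :
    ∃ f : Submodule ℝ (EuclideanSpace ℝ (Fin n)) → (EuclideanSpace ℝ (Fin n) →ₗ[ℝ] ℝ),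
      ∀ H ∈ 𝓗.planes, LinearMap.ker (f H) = H := by
  have : ∀ H : Submodule ℝ (EuclideanSpace ℝ (Fin n)),
      ∃ f : EuclideanSpace ℝ (Fin n) →ₗ[ℝ] ℝ, H ∈ 𝓗.planes → LinearMap.ker f = H := by
    intro H
    by_cases hH : H ∈ 𝓗.planes
    · have h1 := 𝓗.finrank_add_one H hH
      have hlt : H < ⊤ := by
        refine lt_top_iff_ne_top.2 fun h => ?_
        rw [h, finrank_top, finrank_euclideanSpace, Fintype.card_fin] at h1
        omega
      obtain ⟨f, hf, hle⟩ := H.exists_le_ker_of_lt_top hlt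
      have h2 := Module.Dual.finrank_ker_add_one_of_ne_zero hf
      rw [finrank_euclideanSpace, Fintype.card_fin] at h2
      exact ⟨f, fun _ => (Submodule.eq_of_le_of_finrank_eq hle (by omega)).symm⟩
    · exact ⟨0, fun h => absurd h hH⟩
  choose f hf using this
  exact ⟨f, hf⟩

theorem sameRegion_iff_sign {𝓗 : Arrangement n}
    {f : Submodule ℝ (EuclideanSpace ℝ (Fin n)) → (EuclideanSpace ℝ (Fin n) →ₗ[ℝ] ℝ)}
    (hf : ∀ H ∈ 𝓗.planes, LinearMap.ker (f H) = H) (p q : EuclideanSpace ℝ (Fin n)) :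
    SameRegion 𝓗 p q ↔
      ∀ H ∈ 𝓗.planes, SignType.sign (f H p) = SignType.sign (f H q) := by
  refine forall₂_congr fun H hH => ?_
  rw [← sameSide_iff_sign, hf H hH]

/-- Close to `p`, the segment from `p` towards `q` has the sign of `p` for a functional that does
not vanish at `p`, and the sign of `q` otherwise. -/
theorem eventually_sign {E : Type*} [AddCommGroup E] [Module ℝ E] (f : E →ₗ[ℝ] ℝ) (p q : E) :
    ∀ᶠ t : ℝ in 𝓝[>] 0, SignType.sign (f (AffineMap.lineMap p q t)) =
      if SignType.sign (f p) = 0 then SignType.sign (f q) else SignType.sign (f p) := by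
  have hval : ∀ t : ℝ, f (AffineMap.lineMap p q t) = f p + t * (f q - f p) := by
    intro t
    rw [AffineMap.lineMap_apply_module', map_add, map_smul, map_sub, smul_eq_mul]
    ring
  have hlim : Tendsto (fun t : ℝ => f p + t * (f q - f p)) (𝓝[>] 0) (𝓝 (f p)) := by
    have : Continuous fun t : ℝ => f p + t * (f q - f p) := by fun_prop
    simpa using (this.tendsto 0).mono_left nhdsWithin_le_nhds
  simp only [hval]
  rcases lt_trichotomy (f p) 0 with h | h | h
  · filter_upwards [hlim.eventually_lt_const h] with t ht
    rw [sign_neg h, if_neg (by decide), sign_neg ht]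
  · filter_upwards [self_mem_nhdsWithin] with t ht
    rw [h, sign_zero, if_pos rfl, zero_add, sub_zero, sign_mul, sign_pos ht, one_mul]
  · filter_upwards [hlim.eventually_const_lt h] with t ht
    rw [sign_pos h, if_neg (by decide), sign_pos ht]

/-- The product of two faces is a face: nearby, all segments from `F` towards `G` run in one and
the same region. -/
theorem reached_face (𝓗 : Arrangement n) (F G : Face 𝓗) :
    ∃ p, reached 𝓗 F.1 G.1 = {q | SameRegion 𝓗 p q} := by
  obtain ⟨f, hf⟩ := exists_functionals 𝓗
  obtain ⟨F, a, rfl⟩ := F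
  obtain ⟨G, b, rfl⟩ := G
  have hev : ∀ p q, ∀ᶠ t : ℝ in 𝓝[>] 0, ∀ H ∈ 𝓗.planes,
      SignType.sign (f H (AffineMap.lineMap p q t)) =
        if SignType.sign (f H p) = 0 then SignType.sign (f H q) else SignType.sign (f H p) :=
    fun p q => (Filter.eventually_all_finset _).2 fun H _ => eventually_sign (f H) p q
  obtain ⟨t₀, ht₀⟩ := (hev a b).exists
  refine ⟨AffineMap.lineMap a b t₀, Set.ext fun r => ⟨fun h => ?_, fun h => ?_⟩⟩
  · obtain ⟨t, h1, h2⟩ := ((h a ((sameRegion_iff_sign hf _ _).2 fun _ _ => rfl) b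
      ((sameRegion_iff_sign hf _ _).2 fun _ _ => rfl)).and (hev a b)).exists
    refine (sameRegion_iff_sign hf _ _).2 fun H hH => ?_
    rw [ht₀ H hH, ← h2 H hH, (sameRegion_iff_sign hf _ _).1 h1 H hH]
  · intro p hp q hq
    filter_upwards [hev p q] with t ht
    refine (sameRegion_iff_sign hf _ _).2 fun H hH => ?_
    rw [ht H hH, ← (sameRegion_iff_sign hf _ _).1 hp H hH,
      ← (sameRegion_iff_sign hf _ _).1 hq H hH, ← ht₀ H hH,
      (sameRegion_iff_sign hf _ _).1 h H hH]

/-- The product of faces; `Face 𝓗` with it is the hyperplane face monoid. -/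
instance (𝓗 : Arrangement n) : Mul (Face 𝓗) where
  mul F G := ⟨reached 𝓗 F.1 G.1, reached_face 𝓗 F G⟩

/-- `S` is isomorphic to a hyperplane face semigroup: a family of faces of a hyperplane
arrangement, in some `ℝⁿ`, that is closed under the product of faces. -/
def IsHyperplaneFaceSemigroup (S : Type*) [Mul S] : Prop :=
  ∃ (n : ℕ) (𝓗 : Arrangement n) (T : Subsemigroup (Face 𝓗)), Nonempty (S ≃* T)

end Override

end

noncomputable section

namespace Override

/-! ### Separation by homomorphisms to the three-element monoid -/

/-! Recording a partial function at a point as undefined, equal to a fixed `y`, or defined otherwise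
turns override into the product of `L`: undefined is neutral and a defined value wins. Hence
representability means that homomorphisms to `L` separate points (`isRepresentable_iff_separated`).
Quasi-identities of `L` pass to such algebras and the axioms hold in `L`, so parts 1 and 3 reduce to
deducing separation from the axioms (`separated_of_zigzagFree`).

After an identity is adjoined, a homomorphism sending the identity to zero consists of a zero set,
which is a submonoid whose complement is an ideal, and a two-colouring of the complement, invariant
under right multiplication by anything and left multiplication by the zero set. Points of different
support are told apart by one colour. If `x` and `y` have the same support, take as zero set a
submonoid `F` maximal among those with no element identifying `x` and `y`. If the invariance forced
`x` and `y` to have the same colour, left multiplication by a single `e` in `F` would turn the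
forcing chain into a zigzag joining `e * x` to `e * y`; the axioms `lam n` then give `e * x = e *
y`, contrary to the choice of `F`.

For part 2, the signs of linear functionals multiply as in `L`, and the coordinate hyperplanes
realise the whole power of `L`.

For part 4, compactness leaves the task of satisfying any finite part of the axioms without
satisfying all. `CutCircle k` consists of the faces other than the origin of `k` lines in the plane,
with one arc doubled. Every element identifies the two copies, but a zigzag joining them must go all
the way round, so `lam n` holds for small `n` and fails for `n = 2 * k - 1`. -/

/-- The homomorphisms to `L` separate the points of `S`. -/
def Separated (S : Type*) [Mul S] : Prop :=
  ∀ a b : S, (∀ φ : S →ₙ* L, φ a = φ b) → a = b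

theorem L.zero_mul_eq (a : L) : L.zero * a = a := rfl
theorem L.plus_mul_eq (a : L) : L.plus * a = L.plus := rfl
theorem L.minus_mul_eq (a : L) : L.minus * a = L.minus := rfl

/-- The value of a partial function at `x`, recorded as undefined, equal to `y`, or other. -/
def valueAt {X Y : Type*} (x : X) (y : Y) (f : X →. Y) : L :=
  open Classical in
  if (f x).Dom then if y ∈ f x then L.plus else L.minus else L.zero

theorem valueAt_override {X Y : Type*} (x : X) (y : Y) (f g : X →. Y) :
    valueAt x y (override f g) = valueAt x y f * valueAt x y g := by
  by_cases hf : (f x).Dom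
  · by_cases hy : y ∈ f x <;> simp [valueAt, override, hf, hy, L.plus_mul_eq, L.minus_mul_eq]
  · have h : override f g x = g x := if_neg hf
    have h0 : valueAt x y f = L.zero := if_neg hf
    rw [h0, L.zero_mul_eq, valueAt, valueAt, h]

theorem valueAt_injective {X Y : Type*} {f g : X →. Y}
    (h : ∀ x y, valueAt x y f = valueAt x y g) : f = g := by
  funext x
  refine Part.ext fun y => ?_
  have key : ∀ f : X →. Y, y ∈ f x ↔ valueAt x y f = L.plus := by
    intro f
    by_cases hf : (f x).Dom
    · by_cases hy : y ∈ f x <;> simp [valueAt, hf, hy]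
    · have : y ∉ f x := fun hy => hf (Part.dom_iff_mem.2 ⟨y, hy⟩)
      simp [valueAt, hf, this]
  rw [key, key, h]

theorem isRepresentable_iff_separated (S : Type u) [Mul S] :
    IsRepresentable S ↔ Separated S := by
  constructor
  · rintro ⟨X, Y, _, _, f, hf, hmul⟩ a b h
    refine hf (valueAt_injective fun x y => ?_)
    exact h ⟨fun s => valueAt x y (f s), fun s t => by
      rw [hmul, valueAt_override]⟩
  · intro h
    let f : S → ((S →ₙ* L) →. ULift.{u} L) := fun a φ => ⟨φ a ≠ L.zero, fun _ => ⟨φ a⟩⟩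
    have hdom : ∀ a φ, (f a φ).Dom ↔ φ a ≠ L.zero := fun a φ => Iff.rfl
    -- The constant homomorphism `plus` keeps the domain nonempty even when `S` is empty.
    refine ⟨S →ₙ* L, ULift.{u} L, ⟨⟨fun _ => L.plus, fun _ _ => rfl⟩⟩, ⟨⟨L.zero⟩⟩, f, ?_, ?_⟩
    · intro a b hab
      refine h a b fun φ => ?_
      have h1 : f a φ = f b φ := congrFun hab φ
      by_cases ha : φ a = L.zero
      · by_contra hne
        have hb : (f b φ).Dom := fun hb => hne (ha.trans hb.symm)
        rw [← h1] at hb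
        exact hb ha
      · have h2 : (⟨φ a⟩ : ULift.{u} L) ∈ f a φ := ⟨ha, rfl⟩
        rw [h1] at h2
        obtain ⟨_, h3⟩ := h2
        exact (congrArg ULift.down h3).symm
    · intro a b
      funext φ
      have hval : ∀ c, f c φ = ⟨φ c ≠ L.zero, fun _ => ⟨φ c⟩⟩ := fun _ => rfl
      by_cases ha : φ a = L.zero
      · rw [override, if_neg (by rw [hdom]; exact not_not.2 ha), hval, hval, map_mul, ha, L.zero_mul_eq]
      · have : φ (a * b) = φ a := by
          rw [map_mul]
          revert ha
          cases φ a
          · intro ha; exact absurd rfl ha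
          · intro _; rfl
          · intro _; rfl
        rw [override, if_pos ((hdom a φ).2 ha), hval, hval, this]

/-- A homomorphism of magmas as a homomorphism of first-order structures. -/
def mulHomToHom {S S' : Type*} [Mul S] [Mul S'] (φ : S →ₙ* S') : S →[magmaLang] S' where
  toFun := φ
  map_fun' f v := by cases f; exact map_mul φ _ _
  map_rel' r := r.elim

theorem Separated.inQuasivarietyOf {S : Type*} [Mul S] (h : Separated S) :
    InQuasivarietyOf L S := by
  intro q hq
  rw [QuasiIdentity.realize_toSentence] at hq ⊢
  intro v hv
  refine h _ _ fun φ => ?_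
  have key : ∀ t : magmaLang.Term (Fin q.k), t.realize (φ ∘ v) = φ (t.realize v) :=
    fun t => Language.HomClass.realize_term (mulHomToHom φ)
  rw [← key, ← key]
  refine hq _ fun e he => ?_
  rw [key, key, hv e he]

theorem L.models_assocLaw : L ⊨ assocLaw.toSentence :=
  realize_assocLaw.2 fun x y z => (mul_assoc x y z).symm

theorem L.models_idemLaw : L ⊨ idemLaw.toSentence :=
  realize_idemLaw.2 fun x => by cases x <;> rfl

theorem L.models_leftRegularLaw : L ⊨ leftRegularLaw.toSentence :=
  realize_leftRegularLaw.2 fun x y => by cases x <;> cases y <;> rfl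

/-- If `x ≠ y`, no `z i` is the identity, so all are left zeros; the remaining premises then read `x
= z 1 = z 2 = … = y`. -/
theorem L.models_lam (n : ℕ) : L ⊨ (lam n).toSentence := by
  refine (realize_lam n).2 fun x y z hxy hyx h1 h2 hz hzz => ?_
  by_contra hne
  have h0 : ∀ i, 1 ≤ i → i ≤ 2 * n + 1 → ∀ a, z i * a = z i := by
    intro i hi hi' a
    have := hz i hi hi'
    revert this
    cases z i
    · intro h; exact absurd h hne
    · intro _; rfl
    · intro _; rfl
  have hpath : ∀ i, i ≤ n → z (2 * i + 1) = x := by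
    intro i
    induction i with
    | zero => intro _; rw [← h1, h0 _ (by omega) (by omega)]
    | succ i ih =>
      intro hi
      have h3 := hzz (i + 1) (by omega) hi
      rw [h0 _ (by omega) (by omega), h0 _ (by omega) (by omega)] at h3
      rw [h3.2, ← h3.1]
      exact ih (by omega)
  refine hne ?_
  rw [← hpath n le_rfl, ← h2, h0 _ (by omega) (by omega)]

theorem InQuasivarietyOf.models_sigmaL {S : Type*} [Mul S] (h : InQuasivarietyOf L S) :
    S ⊨ sigmaL := by
  refine ⟨?_⟩
  rintro φ ((rfl | rfl | rfl) | ⟨n, -, rfl⟩)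
  · exact h _ L.models_assocLaw
  · exact h _ L.models_idemLaw
  · exact h _ L.models_leftRegularLaw
  · exact h _ (L.models_lam n)

/-! ### Left regular bands without forbidden zigzags -/

/-- `a` and `b` identify `u` with `v` when they act on the left, and `b` is below `a`. -/
def Below {M : Type*} [Mul M] (u v a b : M) : Prop :=
  a * u = a * v ∧ b * u = b * v ∧ a * b = b

/-- Points with the same support are equal as soon as they are joined by a zigzag of elements
identifying them. -/
def ZigzagFree (M : Type*) [Mul M] : Prop :=
  ∀ u v : M, u * v = u → v * u = v → Relation.EqvGen (Below u v) u v → u = v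

/-! ### Two-colouring the complement of a maximal submonoid -/

section Monoid

variable {M : Type*} [Monoid M]

/-- Left regularity, `f * c * f = f * c`, lets a left factor `f` be inserted on both sides of a
product. This allows zigzags found for different `e` to be moved to a common one. -/
theorem Below.mul_left (hM : ∀ a b : M, a * b * a = a * b) {x y e a b : M} (f : M)
    (h : Below (e * x) (e * y) a b) : Below (f * e * x) (f * e * y) (f * a) (f * b) := by
  have key : ∀ c : M, c * (e * x) = c * (e * y) →
      f * c * (f * e * x) = f * c * (f * e * y) := by
    intro c hc
    have h1 : ∀ w, f * c * (f * e * w) = f * (c * (e * w)) := by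
      intro w
      calc f * c * (f * e * w) = f * c * f * (e * w) := by simp only [mul_assoc]
        _ = f * (c * (e * w)) := by rw [hM]; simp only [mul_assoc]
    rw [h1, h1, hc]
  refine ⟨key a h.1, key b h.2.1, ?_⟩
  calc f * a * (f * b) = f * a * f * b := by simp only [mul_assoc]
    _ = f * b := by rw [hM, mul_assoc, h.2.2]

theorem eqvGen_below_mul_left (hM : ∀ a b : M, a * b * a = a * b) {x y e a b : M} (f : M)
    (h : Relation.EqvGen (Below (e * x) (e * y)) a b) :
    Relation.EqvGen (Below (f * e * x) (f * e * y)) (f * a) (f * b) := by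
  induction h with
  | rel a b h => exact .rel _ _ (h.mul_left hM f)
  | refl a => exact .refl _
  | symm a b _ ih => exact ih.symm
  | trans a b c _ _ ih1 ih2 => exact ih1.trans _ _ _ ih2

/-- The elements that identify `e * x` with `e * y` for some `e` in `F`. -/
def identifying (F : Submonoid M) (x y : M) : Set M :=
  {z | ∃ e ∈ F, z * (e * x) = z * (e * y)}

/-- One step of the relation that a homomorphism to `L` with zero set `F` has to respect. -/
inductive Step (F : Submonoid M) (x y : M) : M → M → Prop
  | right (a w : M) (ha : a ∈ identifying F x y) : Step F x y a (a * w)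
  | left (a w : M) (ha : a ∈ F) (hw : w ∈ identifying F x y) : Step F x y w (a * w)

/-- A right step becomes one `Below` step after multiplication by its witness `e`; a left step by
`a` collapses after multiplication by `a`, since `a * a = a`. Finitely many steps need only one
common multiplier. -/
theorem exists_eqvGen_below_of_step (hM : ∀ a b : M, a * b * a = a * b) {F : Submonoid M} {x y a b : M}
    (h : Relation.EqvGen (Step F x y) a b) :
    ∃ e ∈ F, Relation.EqvGen (Below (e * x) (e * y)) (e * a) (e * b) := by
  induction h with
  | rel a b h =>
    cases h with
    | right a w ha =>
      obtain ⟨e, he, h⟩ := ha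
      have h1 : e * a * (e * x) = e * a * (e * y) := by rw [mul_assoc, h, ← mul_assoc]
      have h2 : ∀ w v : M, e * (a * w) * (e * v) = e * a * w * (e * a * (e * v)) := by
        intro w v
        rw [← mul_assoc (e * a * w), hM, mul_assoc e a w]
      refine ⟨e, he, .rel _ _ ⟨h1, ?_, ?_⟩⟩
      · rw [h2, h2, h1]
      · have h3 := hM (e * a) 1
        simp only [mul_one] at h3
        rw [← mul_assoc e a w, ← mul_assoc (e * a), h3]
    | left a w ha hw =>
      refine ⟨a, ha, ?_⟩
      have h3 := hM a 1
      simp only [mul_one] at h3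
      rw [← mul_assoc, h3]
      exact .refl _
  | refl a => exact ⟨1, F.one_mem, .refl _⟩
  | symm a b _ ih =>
    obtain ⟨e, he, h⟩ := ih
    exact ⟨e, he, h.symm⟩
  | trans a b c _ _ ih1 ih2 =>
    obtain ⟨e, he, h1⟩ := ih1
    obtain ⟨f, hf, h2⟩ := ih2
    -- The order matters: `f * e * f = f * e` makes this product absorb both multipliers.
    refine ⟨f * e, F.mul_mem hf he, ?_⟩
    have h3 := eqvGen_below_mul_left hM f h1
    have h4 := eqvGen_below_mul_left hM (f * e) h2
    have h5 : f * e * f = f * e := hM f e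
    rw [h5, ← mul_assoc, ← mul_assoc, h5] at h4
    rw [← mul_assoc, ← mul_assoc] at h3
    exact h3.trans _ _ _ h4

/-- A submonoid that is maximal among those with `z * x ≠ z * y` for all elements `z`. -/
theorem exists_maximal_submonoid {x y : M} (hne : x ≠ y) :
    ∃ F : Submonoid M, Maximal (fun F : Submonoid M => ∀ z ∈ F, z * x ≠ z * y) F := by
  obtain ⟨F, -, hF⟩ := zorn_le_nonempty₀ {F : Submonoid M | ∀ z ∈ F, z * x ≠ z * y} (by
    intro c hc hchain F hF
    refine ⟨sSup c, ?_, fun _ => le_sSup⟩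
    intro z hz
    obtain ⟨G, hG, hzG⟩ := (Submonoid.mem_sSup_of_directedOn ⟨F, hF⟩ hchain.directedOn).1 hz
    exact hc hG z hzG) ⊥ (by
      intro z hz
      rw [Submonoid.mem_bot.1 hz, one_mul, one_mul]
      exact hne)
  exact ⟨F, hF⟩

/-- An element `z` outside both sets would allow `F` to be enlarged to the submonoid `G` of all `w`
fixing some `e * z` on the right: `G` contains `F` and `z`, and a `w` in `G` identifying `x` with
`y` would make `z` identify `e * x` with `e * y`. -/
theorem notMem_iff_mem_identifying (hM : ∀ a b : M, a * b * a = a * b) {F : Submonoid M} {x y : M}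
    (hF : Maximal (fun F : Submonoid M => ∀ z ∈ F, z * x ≠ z * y) F) (z : M) :
    z ∉ F ↔ z ∈ identifying F x y := by
  constructor
  · intro hz
    by_contra hK
    have hidem : ∀ a : M, a * a = a := fun a => by simpa using hM a 1
    have hstep : ∀ {d e w : M}, e * z * w = e * z → d * e * z * w = d * e * z := by
      intro d e w h
      calc d * e * z * w = d * (e * z * w) := by simp only [mul_assoc]
        _ = d * e * z := by rw [h]; simp only [mul_assoc]
    let G : Submonoid M :=
      { carrier := {w | ∃ e ∈ F, e * z * w = e * z}
        one_mem' := ⟨1, F.one_mem, mul_one _⟩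
        mul_mem' := by
          rintro v w ⟨d, hd, hv⟩ ⟨e, he, hw⟩
          refine ⟨d * e, F.mul_mem hd he, ?_⟩
          have h1 : d * e * z * v = d * e * z := by
            have := hstep (d := d * e) hv
            rwa [hM] at this
          rw [← mul_assoc, h1, hstep hw] }
    have hFG : F ≤ G := fun w hw => ⟨w, hw, hM w z⟩
    have hzG : z ∈ G := ⟨1, F.one_mem, by rw [one_mul, hidem]⟩
    refine hz (hF.le_of_ge ?_ hFG hzG)
    rintro w ⟨e, he, hw⟩ h
    refine hK ⟨e, he, ?_⟩
    have h1 : e * z * x = e * z * y := by rw [← hw, mul_assoc, h, ← mul_assoc]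
    have h2 : ∀ v, z * (e * v) = z * (e * z * v) := by
      intro v
      rw [← mul_assoc, ← hM z e]
      simp only [mul_assoc]
    rw [h2, h2, h1]
  · rintro ⟨e, he, h⟩ hz
    refine hF.prop (z * e) (F.mul_mem hz he) ?_
    rw [mul_assoc, mul_assoc, h]

theorem mul_mem_identifying_left {F : Submonoid M} {x y z : M} (w : M)
    (hz : z ∈ identifying F x y) : w * z ∈ identifying F x y := by
  obtain ⟨e, he, h⟩ := hz
  exact ⟨e, he, by rw [mul_assoc, h, mul_assoc]⟩

theorem mul_mem_identifying_right (hM : ∀ a b : M, a * b * a = a * b) {F : Submonoid M} {x y z : M}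
    (w : M) (hz : z ∈ identifying F x y) : z * w ∈ identifying F x y := by
  obtain ⟨e, he, h⟩ := hz
  refine ⟨e, he, ?_⟩
  have h1 : ∀ v, z * w * (e * v) = z * w * (z * (e * v)) := by
    intro v
    rw [← mul_assoc _ z, hM]
  rw [h1, h1, h]

theorem exists_hom_ne_of_zigzagFree (hM : ∀ a b : M, a * b * a = a * b) (hzz : ZigzagFree M)
    {x y : M} (hxy : x * y = x) (hyx : y * x = y) (hne : x ≠ y) :
    ∃ φ : M →ₙ* L, φ x ≠ φ y := by
  classical
  obtain ⟨F, hF⟩ := exists_maximal_submonoid hne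
  have hK := notMem_iff_mem_identifying hM hF
  -- Equal support makes `x` and `y` themselves identifying, so both lie outside `F` and receive a
  -- colour.
  have hself : ∀ {u v : M}, u * v = u → ∀ e, u * (e * u) = u * (e * v) := by
    intro u v huv e
    have h1 : u * (e * u) = u * e := by rw [← mul_assoc, hM]
    have h2 : u * (e * v) = u * e := by
      calc u * (e * v) = u * v * (e * v) := by rw [huv]
        _ = u * (v * e * v) := by simp only [mul_assoc]
        _ = u * e := by rw [hM, ← mul_assoc, huv]
    rw [h1, h2]
  have hx : x ∈ identifying F x y := ⟨1, F.one_mem, hself hxy 1⟩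
  have hy : y ∈ identifying F x y := ⟨1, F.one_mem, (hself hyx 1).symm⟩
  have hnot : ¬ Relation.EqvGen (Step F x y) x y := by
    intro h
    obtain ⟨e, he, h⟩ := exists_eqvGen_below_of_step hM h
    refine hF.prop e he (hzz _ _ ?_ ?_ h)
    · rw [← mul_assoc, hM, mul_assoc, hxy]
    · rw [← mul_assoc, hM, mul_assoc, hyx]
  let φ : M → L := fun z =>
    if z ∈ F then L.zero else if Relation.EqvGen (Step F x y) x z then L.plus else L.minus
  have hφ0 : ∀ {z}, z ∈ F → φ z = L.zero := fun hz => if_pos hz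
  have hcongr : ∀ {a b}, a ∈ identifying F x y → b ∈ identifying F x y → Step F x y a b →
      φ a = φ b := by
    intro a b ha hb hab
    have h1 : Relation.EqvGen (Step F x y) x a ↔ Relation.EqvGen (Step F x y) x b :=
      ⟨fun h => h.trans _ _ _ (.rel _ _ hab), fun h => h.trans _ _ _ (.symm _ _ (.rel _ _ hab))⟩
    simp only [φ, (hK a).2 ha, (hK b).2 hb, if_false, h1]
  refine ⟨⟨φ, fun z w => ?_⟩, ?_⟩
  · by_cases hz : z ∈ F
    · by_cases hw : w ∈ F
      · rw [hφ0 hz, hφ0 hw, hφ0 (F.mul_mem hz hw)]; rfl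
      · have hw' := (hK w).1 hw
        rw [hφ0 hz, L.zero_mul_eq]
        exact (hcongr hw' (mul_mem_identifying_left z hw') (.left z w hz hw')).symm
    · have hz' := (hK z).1 hz
      rw [← hcongr hz' (mul_mem_identifying_right hM w hz') (.right z w hz')]
      simp only [φ, hz, if_false]
      split_ifs <;> rfl
  · change φ x ≠ φ y
    simp only [φ, (hK x).2 hx, (hK y).2 hy, if_false, if_pos (Relation.EqvGen.refl x), if_neg hnot]
    simp

end Monoid

/-- `t` is joined to `u` by a zigzag of `2 * n + 1` elements identifying `u` with `v`. -/
def HasZigzag {S : Type*} [Mul S] (u v t : S) : Prop :=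
  ∃ n, 1 ≤ n ∧ ∃ z : ℕ → S, z 1 * u = u ∧ z (2 * n + 1) * t = t ∧
    (∀ i, 1 ≤ i → i ≤ 2 * n + 1 → z i * u = z i * v) ∧
    ∀ i, 1 ≤ i → i ≤ n →
      z (2 * i - 1) * z (2 * i) = z (2 * i) ∧ z (2 * i + 1) * z (2 * i) = z (2 * i)

/-- Going down keeps the same zigzag, because its last element fixes `a` and hence `a * b = b`.
Going up appends `b` and `a`, which keeps the length odd. -/
theorem HasZigzag.of_below {S : Type*} [Semigroup S] (hidem : ∀ x : S, x * x = x) {u v a b : S}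
    (hab : Below u v a b) :
    HasZigzag u v a ↔ HasZigzag u v b := by
  constructor
  · rintro ⟨n, hn, z, h1, h2, h3⟩
    refine ⟨n, hn, z, h1, ?_, h3⟩
    rw [← hab.2.2, ← mul_assoc, h2]
  · rintro ⟨n, hn, z, h1, h2, h3, h4⟩
    let w : ℕ → S := fun i => if i ≤ 2 * n + 1 then z i else if i = 2 * n + 2 then b else a
    have hw : ∀ i, i ≤ 2 * n + 1 → w i = z i := fun i hi => if_pos hi
    have hwb : ∀ i, i = 2 * n + 2 → w i = b := fun i hi => by
      simp only [w]; rw [if_neg (by omega), if_pos hi]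
    have hwa : ∀ i, i = 2 * n + 3 → w i = a := fun i hi => by
      simp only [w]; rw [if_neg (by omega), if_neg (by omega)]
    refine ⟨n + 1, by omega, w, ?_, ?_, ?_, ?_⟩
    · rw [hw 1 (by omega), h1]
    · rw [hwa _ (by omega), hidem]
    · intro i hi hi'
      rcases (by omega : i ≤ 2 * n + 1 ∨ i = 2 * n + 2 ∨ i = 2 * n + 3) with h | h | h
      · rw [hw i h, h3 i hi h]
      · rw [hwb i h, hab.2.1]
      · rw [hwa i h, hab.1]
    · intro i hi hi'
      rcases (by omega : i ≤ n ∨ i = n + 1) with h | rfl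
      · rw [hw _ (by omega), hw _ (by omega), hw _ (by omega)]
        exact h4 i hi h
      · rw [hw (2 * (n + 1) - 1) (by omega), hwb _ (by omega), hwa _ (by omega)]
        exact ⟨h2, hab.2.2⟩

theorem zigzagFree_of_models_lam {S : Type*} [Semigroup S] (hidem : ∀ x : S, x * x = x)
    (hlam : ∀ n, 1 ≤ n → S ⊨ (lam n).toSentence) : ZigzagFree S := by
  intro u v huv hvu h
  have hiff : ∀ {a b : S}, Relation.EqvGen (Below u v) a b →
      (HasZigzag u v a ↔ HasZigzag u v b) := by
    intro a b h
    induction h with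
    | rel a b h => exact HasZigzag.of_below hidem h
    | refl a => rfl
    | symm a b _ ih => exact ih.symm
    | trans a b c _ _ ih1 ih2 => exact ih1.trans ih2
  -- The constant zigzag at `u`, of length three because the axioms start at `n = 1`.
  have hu : HasZigzag u v u :=
    ⟨1, le_rfl, fun _ => u, hidem u, hidem u, fun _ _ _ => by rw [hidem, huv],
      fun _ _ _ => ⟨hidem u, hidem u⟩⟩
  obtain ⟨n, hn, z, h1, h2, h3, h4⟩ := (hiff h).1 hu
  exact (realize_lam n).1 (hlam n hn) u v z huv hvu h1 h2 h3 h4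

/-- The new identity identifies `u` with `v` only if they are equal, so no nontrivial zigzag passes
through it. -/
theorem ZigzagFree.withOne {S : Type*} [Semigroup S] (hS : ZigzagFree S) :
    ZigzagFree (WithOne S) := by
  intro u v huv hvu h
  induction u using WithOne.recOneCoe with
  | one => rwa [one_mul, eq_comm] at huv
  | coe u =>
  induction v using WithOne.recOneCoe with
  | one => rwa [one_mul] at hvu
  | coe v =>
  by_contra hne
  have hcoe : ∀ {a b : WithOne S}, Relation.EqvGen (Below (u : WithOne S) v) a b →
      a = b ∨ ∃ a' b' : S, a = a' ∧ b = b' ∧ Relation.EqvGen (Below u v) a' b' := by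
    intro a b h
    induction h with
    | rel a b h =>
      obtain ⟨h1, h2, h3⟩ := h
      induction a using WithOne.recOneCoe with
      | one => exact absurd (by simpa only [one_mul] using h1) hne
      | coe a =>
      induction b using WithOne.recOneCoe with
      | one => exact absurd (by simpa only [one_mul] using h2) hne
      | coe b =>
      exact .inr ⟨a, b, rfl, rfl, .rel _ _ (by exact_mod_cast (⟨h1, h2, h3⟩ :
        (a * u : WithOne S) = a * v ∧ (b * u : WithOne S) = b * v ∧ (a * b : WithOne S) = b))⟩
    | refl a => exact .inl rfl
    | symm a b _ ih =>
      rcases ih with h | ⟨a', b', ha, hb, h⟩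
      · exact .inl h.symm
      · exact .inr ⟨b', a', hb, ha, h.symm⟩
    | trans a b c _ _ ih1 ih2 =>
      rcases ih1 with rfl | ⟨a', b', ha, hb, h1⟩
      · exact ih2
      · rcases ih2 with rfl | ⟨b'', c', hb', hc, h2⟩
        · exact .inr ⟨a', b', ha, hb, h1⟩
        · obtain rfl : b' = b'' := WithOne.coe_inj.1 (hb.symm.trans hb')
          exact .inr ⟨a', c', ha, hc, h1.trans _ _ _ h2⟩
  rcases hcoe h with h | ⟨a, b, ha, hb, h⟩
  · exact hne h
  · obtain rfl := WithOne.coe_inj.1 ha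
    obtain rfl := WithOne.coe_inj.1 hb
    refine hne (congrArg _ (hS u v ?_ ?_ h))
    · exact_mod_cast huv
    · exact_mod_cast hvu

theorem separated_of_zigzagFree {S : Type*} [Semigroup S] (hidem : ∀ x : S, x * x = x)
    (hreg : ∀ x y : S, x * y * x = x * y) (hzz : ZigzagFree S) : Separated S := by
  classical
  have hsupp : ∀ x y : S, (∀ φ : S →ₙ* L, φ x = φ y) → x * y = x := by
    intro x y h
    by_contra hne
    -- The elements absorbed by `x` on the right are closed under products and have an ideal as
    -- complement, so they can serve as a zero set with a single colour outside.
    have hiff : ∀ z w : S, x * (z * w) = x ↔ x * z = x ∧ x * w = x := by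
      intro z w
      constructor
      · intro h
        have hz : x * z = x := by
          calc x * z = x * (z * w) * z := by rw [h]
            _ = x * (z * w * z) := by rw [mul_assoc]
            _ = x := by rw [hreg, h]
        refine ⟨hz, ?_⟩
        rw [← mul_assoc, hz] at h
        exact h
      · rintro ⟨hz, hw⟩
        rw [← mul_assoc, hz, hw]
    let φ : S →ₙ* L :=
      ⟨fun z => if x * z = x then L.zero else L.plus, fun z w => by
        simp only [hiff]
        by_cases hz : x * z = x <;> by_cases hw : x * w = x <;> simp [hz, hw, L.zero_mul_eq, L.plus_mul_eq]⟩
    have := h φ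
    change (if x * x = x then L.zero else L.plus) = if x * y = x then L.zero else L.plus at this
    rw [if_pos (hidem x), if_neg hne] at this
    cases this
  intro x y h
  by_contra hne
  have hM : ∀ a b : WithOne S, a * b * a = a * b := by
    intro a b
    induction a using WithOne.recOneCoe with
    | one => simp
    | coe a =>
    induction b using WithOne.recOneCoe with
    | one => simp only [mul_one]; exact_mod_cast hidem a
    | coe b => exact_mod_cast hreg a b
  obtain ⟨φ, hφ⟩ := exists_hom_ne_of_zigzagFree hM hzz.withOne (x := (x : WithOne S)) (y := y)
    (by exact_mod_cast hsupp x y h) (by exact_mod_cast hsupp y x fun φ => (h φ).symm)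
    (fun h => hne (WithOne.coe_inj.1 h))
  exact hφ (h (φ.comp WithOne.coeMulHom))

/-! ### Representability, the axioms and the quasivariety -/

theorem separated_of_models_sigmaL {S : Type*} [Mul S] (h : S ⊨ sigmaL) : Separated S := by
  have hassoc := realize_assocLaw.1 (h.realize_of_mem _ (.inl (.inl rfl)))
  have hidem := realize_idemLaw.1 (h.realize_of_mem _ (.inl (.inr (.inl rfl))))
  have hreg := realize_leftRegularLaw.1 (h.realize_of_mem _ (.inl (.inr (.inr rfl))))
  let : Semigroup S := { mul_assoc := fun x y z => (hassoc x y z).symm }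
  exact separated_of_zigzagFree hidem hreg <|
    zigzagFree_of_models_lam hidem fun n hn => h.realize_of_mem _ (.inr ⟨n, hn, rfl⟩)

theorem isRepresentable_iff_models_sigmaL (S : Type u) [Mul S] :
    IsRepresentable S ↔ S ⊨ sigmaL := by
  rw [isRepresentable_iff_separated]
  exact ⟨fun h => h.inQuasivarietyOf.models_sigmaL, separated_of_models_sigmaL⟩

theorem isRepresentable_iff_inQuasivarietyOf (S : Type u) [Mul S] :
    IsRepresentable S ↔
      (∀ a b c : S, (a * b) * c = a * (b * c)) ∧ InQuasivarietyOf L S := by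
  constructor
  · intro h
    have h1 := ((isRepresentable_iff_separated S).1 h).inQuasivarietyOf
    exact ⟨fun a b c => (realize_assocLaw.1 (h1 _ L.models_assocLaw) a b c).symm, h1⟩
  · rintro ⟨-, h⟩
    exact (isRepresentable_iff_models_sigmaL S).2 h.models_sigmaL

/-! ### Hyperplane face semigroups -/

theorem finite_mulHom (S : Type*) [Mul S] [Finite S] : Finite (S →ₙ* L) := by
  have : Finite L := Finite.of_injective (β := Fin 3)
    (fun | .zero => 0 | .plus => 1 | .minus => 2) (by
      intro a b; cases a <;> cases b <;> simp)
  exact DFunLike.finite _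

/-- Signs as elements of `L`. -/
def signToL : SignType → L
  | .zero => .zero
  | .pos => .plus
  | .neg => .minus

theorem signToL_injective : Function.Injective signToL := by
  intro a b; cases a <;> cases b <;> simp [signToL]

theorem signToL_ite (a b : SignType) :
    signToL (if a = 0 then b else a) = signToL a * signToL b := by
  cases a <;> cases b <;> rfl

theorem sameRegion_refl {n : ℕ} (𝓗 : Arrangement n) (p : EuclideanSpace ℝ (Fin n)) :
    SameRegion 𝓗 p p := by
  obtain ⟨f, hf⟩ := exists_functionals 𝓗
  exact (sameRegion_iff_sign hf _ _).2 fun _ _ => rfl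

/-- A point of a face. -/
def Face.point {n : ℕ} {𝓗 : Arrangement n} (F : Face 𝓗) : EuclideanSpace ℝ (Fin n) :=
  F.2.choose

theorem Face.eq_region {n : ℕ} {𝓗 : Arrangement n} (F : Face 𝓗) :
    F.1 = {q | SameRegion 𝓗 F.point q} :=
  F.2.choose_spec

theorem Face.point_mem {n : ℕ} {𝓗 : Arrangement n} (F : Face 𝓗) : F.point ∈ F.1 := by
  rw [F.eq_region]
  exact sameRegion_refl 𝓗 _

theorem sign_of_mem_reached {n : ℕ} {𝓗 : Arrangement n}
    {f : Submodule ℝ (EuclideanSpace ℝ (Fin n)) → (EuclideanSpace ℝ (Fin n) →ₗ[ℝ] ℝ)}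
    (hf : ∀ H ∈ 𝓗.planes, LinearMap.ker (f H) = H)
    {F G : Set (EuclideanSpace ℝ (Fin n))} {p q r : EuclideanSpace ℝ (Fin n)}
    (hp : p ∈ F) (hq : q ∈ G) (hr : r ∈ reached 𝓗 F G)
    {H : Submodule ℝ (EuclideanSpace ℝ (Fin n))} (hH : H ∈ 𝓗.planes) :
    SignType.sign (f H r) = if SignType.sign (f H p) = 0 then SignType.sign (f H q)
      else SignType.sign (f H p) := by
  obtain ⟨t, h1, h2⟩ := ((hr p hp q hq).and (eventually_sign (f H) p q)).exists
  rw [(sameRegion_iff_sign hf _ _).1 h1 H hH, h2]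

/-- Each hyperplane gives a homomorphism to `L`, the sign of its functional on a face, and these
signs determine the face. -/
theorem separated_face {n : ℕ} (𝓗 : Arrangement n) : Separated (Face 𝓗) := by
  obtain ⟨f, hf⟩ := exists_functionals 𝓗
  intro F G h
  refine Subtype.ext ?_
  rw [F.eq_region, G.eq_region]
  have key : ∀ H ∈ 𝓗.planes,
      SignType.sign (f H F.point) = SignType.sign (f H G.point) := by
    intro H hH
    refine signToL_injective (h ⟨fun F => signToL (SignType.sign (f H F.point)), fun A B => ?_⟩)
    rw [← signToL_ite,
      ← sign_of_mem_reached hf A.point_mem B.point_mem (A * B).point_mem hH]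
  ext q
  simp only [Set.mem_ofPred_eq, sameRegion_iff_sign hf]
  exact forall₂_congr fun H hH => by rw [key H hH]

theorem finite_face {n : ℕ} (𝓗 : Arrangement n) : Finite (Face 𝓗) := by
  obtain ⟨f, hf⟩ := exists_functionals 𝓗
  refine Finite.of_injective (β := 𝓗.planes → SignType)
    (fun F H => SignType.sign (f H F.point)) fun F G h => Subtype.ext ?_
  rw [F.eq_region, G.eq_region]
  ext q
  simp only [Set.mem_ofPred_eq, sameRegion_iff_sign hf]
  refine forall₂_congr fun H hH => ?_
  rw [show SignType.sign (f H F.point) = SignType.sign (f H G.point) from congrFun h ⟨H, hH⟩]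

theorem Separated.of_injective {S S' : Type*} [Mul S] [Mul S'] (h : Separated S') (φ : S →ₙ* S')
    (hφ : Function.Injective φ) : Separated S :=
  fun _ _ hab => hφ (h _ _ fun ψ => hab (ψ.comp φ))

/-- The coordinate functional on `ℝⁿ`. -/
def coordinate (n : ℕ) (i : Fin n) : EuclideanSpace ℝ (Fin n) →ₗ[ℝ] ℝ :=
  { toFun := fun p => p i
    map_add' := fun _ _ => rfl
    map_smul' := fun _ _ => rfl }

theorem coordinate_apply (n : ℕ) (i : Fin n) (p : EuclideanSpace ℝ (Fin n)) :
    coordinate n i p = p i := rfl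

/-- The arrangement of the coordinate hyperplanes of `ℝⁿ`. -/
def coordinateArrangement (n : ℕ) : Arrangement n where
  planes := open Classical in Finset.univ.image fun i => LinearMap.ker (coordinate n i)
  finrank_add_one := by
    classical
    intro H hH
    obtain ⟨i, -, rfl⟩ := Finset.mem_image.1 hH
    have hne : coordinate n i ≠ 0 := fun h => by
      have := LinearMap.congr_fun h (EuclideanSpace.single i 1)
      simp [coordinate_apply] at this
    have := Module.Dual.finrank_ker_add_one_of_ne_zero hne
    rwa [finrank_euclideanSpace, Fintype.card_fin] at this

theorem sameRegion_coordinateArrangement {n : ℕ} (p q : EuclideanSpace ℝ (Fin n)) :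
    SameRegion (coordinateArrangement n) p q ↔
      ∀ i, SignType.sign (p i) = SignType.sign (q i) := by
  classical
  simp only [SameRegion, coordinateArrangement, Finset.mem_image, Finset.mem_univ, true_and,
    forall_exists_index, forall_apply_eq_imp_iff, sameSide_iff_sign, coordinate_apply]

/-- A real number with a prescribed sign. -/
def L.toReal : L → ℝ
  | .zero => 0
  | .plus => 1
  | .minus => -1

theorem signToL_sign_toReal (a : L) : signToL (SignType.sign a.toReal) = a := by
  cases a <;> simp [L.toReal] <;> rfl

/-- The face of the coordinate arrangement with given signs. -/
def coordinateFace {n : ℕ} (a : Fin n → L) : Face (coordinateArrangement n) :=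
  ⟨{q | SameRegion _ (WithLp.toLp 2 fun i => (a i).toReal) q}, _, rfl⟩

theorem mem_coordinateFace {n : ℕ} (a : Fin n → L) (q : EuclideanSpace ℝ (Fin n)) :
    q ∈ (coordinateFace a).1 ↔ ∀ i, signToL (SignType.sign (q i)) = a i := by
  refine (sameRegion_coordinateArrangement _ q).trans (forall_congr' fun i => ?_)
  rw [← signToL_injective.eq_iff, signToL_sign_toReal, eq_comm]

theorem coordinateFace_mul {n : ℕ} (a b : Fin n → L) :
    coordinateFace (a * b) = coordinateFace a * coordinateFace b := by
  refine Subtype.ext (Set.ext fun r => ?_)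
  have hsign : ∀ (p q : EuclideanSpace ℝ (Fin n)) (i : Fin n), p ∈ (coordinateFace a).1 →
      q ∈ (coordinateFace b).1 → ∀ᶠ t : ℝ in 𝓝[>] 0,
      signToL (SignType.sign ((AffineMap.lineMap p q t : EuclideanSpace ℝ (Fin n)) i)) =
        a i * b i := by
    intro p q i hp hq
    filter_upwards [eventually_sign (coordinate n i) p q] with t ht
    rw [coordinate_apply, coordinate_apply, coordinate_apply] at ht
    rw [ht, signToL_ite, (mem_coordinateFace a p).1 hp i, (mem_coordinateFace b q).1 hq i]
  rw [mem_coordinateFace]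
  constructor
  · intro h p hp q hq
    filter_upwards [eventually_all.2 fun i => hsign p q i hp hq] with t ht
    rw [sameRegion_coordinateArrangement]
    intro i
    exact signToL_injective ((h i).trans (ht i).symm)
  · intro h i
    have hp := (coordinateFace a).point_mem
    have hq := (coordinateFace b).point_mem
    obtain ⟨t, h1, h2⟩ := ((h _ hp _ hq).and (hsign _ _ i hp hq)).exists
    rw [(sameRegion_coordinateArrangement _ _).1 h1 i, h2, Pi.mul_apply]

theorem coordinateFace_injective {n : ℕ} :
    Function.Injective (coordinateFace : (Fin n → L) → Face (coordinateArrangement n)) := by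
  intro a b h
  funext i
  have hp := (coordinateFace a).point_mem
  rw [← (mem_coordinateFace a _).1 hp i]
  exact (mem_coordinateFace b _).1 (h ▸ hp) i

/-- A finite `S` has finitely many homomorphisms to `L`; one coordinate for each embeds it into the
faces of the coordinate arrangement. -/
theorem finite_and_isRepresentable_iff (S : Type u) [Mul S] :
    (Finite S ∧ IsRepresentable S) ↔ IsHyperplaneFaceSemigroup S := by
  rw [isRepresentable_iff_separated]
  constructor
  · rintro ⟨_, hS⟩
    have := finite_mulHom S
    obtain ⟨n, ⟨e⟩⟩ := Finite.exists_equiv_fin (S →ₙ* L)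
    let φ : S →ₙ* Face (coordinateArrangement n) :=
      ⟨fun s => coordinateFace fun i => e.symm i s, fun s t => by
        rw [← coordinateFace_mul]
        congr 1
        funext i
        exact map_mul _ _ _⟩
    have hφ : Function.Injective φ := by
      intro s t h
      refine hS s t fun ψ => ?_
      simpa using congrFun (coordinateFace_injective h) (e ψ)
    refine ⟨n, coordinateArrangement n, φ.srange, ⟨MulEquiv.ofBijective φ.srangeRestrict ⟨?_, ?_⟩⟩⟩
    · intro s t h
      exact hφ (congrArg Subtype.val h)
    · exact φ.srangeRestrict_surjective
  · rintro ⟨n, 𝓗, T, ⟨e⟩⟩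
    have := finite_face 𝓗
    refine ⟨Finite.of_equiv _ e.symm.toEquiv, (separated_face 𝓗).of_injective
      ((MulMemClass.subtype T).comp (e : S →ₙ* T)) ?_⟩
    exact Subtype.val_injective.comp e.injective

/-! ### A circle of rays and arcs with one arc cut in two -/

/-- The product of positions on a circle of `2 * k` rays (odd positions) and `2 * k` arcs (even
positions), where `0` and `4 * k` are the two pieces of one arc. -/
def circleMul (k p q : ℕ) : ℕ :=
  if p % 2 = 0 ∨ q = p ∨ q = p + 2 * k ∨ q + 2 * k = p then p
  else if (p < q ∧ q < p + 2 * k) ∨ q + 2 * k < p then p + 1 else p - 1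

theorem circleMul_le {k p : ℕ} (q : ℕ) (hp : p ≤ 4 * k) : circleMul k p q ≤ 4 * k := by
  unfold circleMul
  split_ifs <;> omega

theorem circleMul_of_even {p : ℕ} (k q : ℕ) (hp : p % 2 = 0) : circleMul k p q = p :=
  if_pos (.inl hp)

/-- This turns identities about the product into linear arithmetic, with the condition for moving to
`p - 1` stated positively. -/
theorem circleMul_cases (k p q : ℕ) :
    (circleMul k p q = p ∧ (p % 2 = 0 ∨ q = p ∨ q = p + 2 * k ∨ q + 2 * k = p)) ∨
    (p % 2 = 1 ∧ circleMul k p q = p + 1 ∧ ((p < q ∧ q < p + 2 * k) ∨ q + 2 * k < p)) ∨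
    (p % 2 = 1 ∧ circleMul k p q = p - 1 ∧ ((q < p ∧ p < q + 2 * k) ∨ p + 2 * k < q)) := by
  unfold circleMul
  split_ifs with h1 h2
  · exact .inl ⟨rfl, h1⟩
  · exact .inr (.inl ⟨by omega, rfl, h2⟩)
  · exact .inr (.inr ⟨by omega, rfl, by omega⟩)

theorem circleMul_assoc {k p q r : ℕ} (hp : p ≤ 4 * k) (hq : q ≤ 4 * k) (hr : r ≤ 4 * k) :
    circleMul k p (circleMul k q r) = circleMul k (circleMul k p q) r := by
  have h1 := circleMul_cases k p q
  have h2 := circleMul_cases k q r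
  have h3 := circleMul_cases k p (circleMul k q r)
  have h4 := circleMul_cases k (circleMul k p q) r
  generalize circleMul k p (circleMul k q r) = a at *
  generalize circleMul k (circleMul k p q) r = b at *
  generalize circleMul k p q = c at *
  generalize circleMul k q r = d at *
  omega

theorem circleMul_self (k p : ℕ) : circleMul k p p = p := if_pos (.inr (.inl rfl))

theorem circleMul_leftRegular {k p q : ℕ} :
    circleMul k (circleMul k p q) p = circleMul k p q := by
  have h1 := circleMul_cases k p q
  have h4 := circleMul_cases k (circleMul k p q) p
  omega

/-- A sequence of natural numbers with steps of length at most one takes all intermediate values. -/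
theorem exists_eq_of_steps {z : ℕ → ℕ} {m : ℕ}
    (hz : ∀ i, i < m → z i ≤ z (i + 1) + 1 ∧ z (i + 1) ≤ z i + 1)
    {v : ℕ} (hv : (z 0 ≤ v ∧ v ≤ z m) ∨ (z m ≤ v ∧ v ≤ z 0)) : ∃ i, i ≤ m ∧ z i = v := by
  induction m with
  | zero => exact ⟨0, le_rfl, by omega⟩
  | succ m ih =>
    by_cases h : z (m + 1) = v
    · exact ⟨m + 1, le_rfl, h⟩
    · have := hz m (by omega)
      obtain ⟨i, hi, h⟩ := ih (fun i hi => hz i (by omega)) (by omega)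
      exact ⟨i, by omega, h⟩

/-- The circle with a cut arc. -/
structure CutCircle (k : ℕ) : Type u where
  val : ℕ
  le : val ≤ 4 * k

instance (k : ℕ) : Mul (CutCircle.{u} k) :=
  ⟨fun p q => ⟨circleMul k p.val q.val, circleMul_le _ p.le⟩⟩

instance (k : ℕ) : Nonempty (CutCircle.{u} k) := ⟨⟨0, Nat.zero_le _⟩⟩

theorem CutCircle.ext {k : ℕ} {p q : CutCircle.{u} k} (h : p.val = q.val) : p = q := by
  cases p; cases q; cases h; rfl

theorem CutCircle.mul_val {k : ℕ} (p q : CutCircle.{u} k) :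
    (p * q).val = circleMul k p.val q.val := rfl

/-- An equation `c * d = d` forces adjacent positions, and the cut prevents steps between `0` and `4
* k`. A zigzag therefore sweeps the interval between `x` and `y`, and some ray there separates them
unless they are the two pieces of the cut arc, which are too far apart. -/
theorem CutCircle.models_lam {k n : ℕ} (hk : 2 ≤ k) (hn : n + 1 < 2 * k) :
    CutCircle.{u} k ⊨ (lam n).toSentence := by
  refine (realize_lam n).2 fun x y z hxy hyx h1 h2 hz hzz => CutCircle.ext ?_
  replace hxy := congrArg val hxy
  replace hyx := congrArg val hyx
  replace h1 := congrArg val h1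
  replace h2 := congrArg val h2
  replace hz := fun i hi hi' => congrArg val (hz i hi hi')
  replace hzz := fun i hi hi' => (hzz i hi hi').imp (congrArg val) (congrArg val)
  simp only [mul_val] at hxy hyx h1 h2 hz hzz
  have hx := x.le
  have hy := y.le
  generalize x.val = a at *
  generalize y.val = b at *
  have hadj : ∀ {c d : ℕ}, circleMul k c d = d → c ≤ d + 1 ∧ d ≤ c + 1 := by
    intro c d h
    have := circleMul_cases k c d
    omega
  have hstep : ∀ j, j < 2 * n → (z (j + 1)).val ≤ (z (j + 1 + 1)).val + 1 ∧
      (z (j + 1 + 1)).val ≤ (z (j + 1)).val + 1 := by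
    intro j hj
    obtain ⟨i, rfl | rfl⟩ := Nat.even_or_odd' j
    · have := (hzz (i + 1) (by omega) (by omega)).1
      exact hadj this
    · have := hadj (hzz (i + 1) (by omega) (by omega)).2
      exact ⟨this.2, this.1⟩
  have ha := hadj h1
  have hb := hadj h2
  have hivt : ∀ v, ((a + 1 ≤ v ∧ v + 1 ≤ b) ∨ (b + 1 ≤ v ∧ v + 1 ≤ a)) →
      circleMul k v a = circleMul k v b := by
    intro v hv
    obtain ⟨i, hi, rfl⟩ := exists_eq_of_steps (z := fun i => (z (i + 1)).val) (m := 2 * n) hstep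
      (v := v) (by simp only [Nat.zero_add]; omega)
    exact hz (i + 1) (by omega) (by omega)
  have hlen : ∀ m, m ≤ 2 * n → (z (m + 1)).val ≤ (z 1).val + m ∧
      (z 1).val ≤ (z (m + 1)).val + m := by
    intro m
    induction m with
    | zero => intro _; exact ⟨le_rfl, le_rfl⟩
    | succ m ih =>
      intro hm
      have := ih (by omega)
      have := hstep m (by omega)
      omega
  have hlen' := hlen (2 * n) le_rfl
  have hab := circleMul_cases k a b
  by_contra hne
  rcases Nat.mod_two_eq_zero_or_one a with hpar | hpar
  · have hba := circleMul_cases k b a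
    have hpar' : b % 2 = 0 := by omega
    rcases Nat.lt_or_gt_of_ne hne with hlt | hlt
    -- The ray after `a` can identify the arcs only if `b` lies beyond its opposite. The ray `a + 2
    -- * k - 1` then separates them unless `a = 0` and `b = 4 * k`, a distance exceeding the `2 * n
    -- + 2` available.
    · have e1 := hivt (a + 1) (by omega)
      have e2 := circleMul_cases k (a + 1) a
      have e3 := circleMul_cases k (a + 1) b
      have e4 : a + 1 + 2 * k < b := by omega
      have e5 := hivt (a + 2 * k - 1) (by omega)
      have e6 := circleMul_cases k (a + 2 * k - 1) a
      have e7 := circleMul_cases k (a + 2 * k - 1) b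
      omega
    · have e1 := hivt (b + 1) (by omega)
      have e2 := circleMul_cases k (b + 1) b
      have e3 := circleMul_cases k (b + 1) a
      have e4 : b + 1 + 2 * k < a := by omega
      have e5 := hivt (b + 2 * k - 1) (by omega)
      have e6 := circleMul_cases k (b + 2 * k - 1) b
      have e7 := circleMul_cases k (b + 2 * k - 1) a
      omega
  · rcases (by omega : b = a + 2 * k ∨ b + 2 * k = a) with h | h
    -- Opposite rays lie on different sides of the next line, whose ray `a + 2` comes strictly
    -- between them because `2 ≤ k`.
    · have e1 := hivt (a + 2) (by omega)
      have e2 := circleMul_cases k (a + 2) a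
      have e3 := circleMul_cases k (a + 2) b
      omega
    · have e1 := hivt (b + 2) (by omega)
      have e2 := circleMul_cases k (b + 2) a
      have e3 := circleMul_cases k (b + 2) b
      omega

/-- The positions `1, …, 4 * k - 1` in order form a zigzag from one piece of the cut arc to the
other, and no position distinguishes the pieces. -/
theorem CutCircle.not_models_lam {k : ℕ} (hk : 1 ≤ k) :
    ¬ CutCircle.{u} k ⊨ (lam (2 * k - 1)).toSentence := by
  intro h
  let z : ℕ → CutCircle.{u} k := fun i => ⟨min i (4 * k), min_le_right _ _⟩
  have hz : ∀ i, i ≤ 4 * k → (z i).val = i := fun i hi => min_eq_left hi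
  have hmul : ∀ i j, i ≤ 4 * k → j ≤ 4 * k → (z i * z j).val = circleMul k i j := by
    intro i j hi hj
    rw [mul_val, hz i hi, hz j hj]
  have heq : ∀ i j, i ≤ 4 * k → j ≤ 4 * k → circleMul k i j = j → z i * z j = z j := by
    intro i j hi hj h
    exact CutCircle.ext (by rw [hmul i j hi hj, hz j hj, h])
  have key := (realize_lam _).1 h (z 0) (z (4 * k)) z ?_ ?_ ?_ ?_ ?_ ?_
  · have := congrArg val key
    rw [hz _ (by omega), hz _ le_rfl] at this
    omega
  · refine CutCircle.ext ?_
    rw [hmul _ _ (by omega) le_rfl, hz _ (by omega), circleMul_of_even _ _ rfl]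
  · refine CutCircle.ext ?_
    rw [hmul _ _ le_rfl (by omega), hz _ le_rfl, circleMul_of_even _ _ (by omega)]
  · have := circleMul_cases k 1 0
    exact heq _ _ (by omega) (by omega) (by omega)
  · have := circleMul_cases k (2 * (2 * k - 1) + 1) (4 * k)
    exact heq _ _ (by omega) (by omega) (by omega)
  · intro i hi hi'
    refine CutCircle.ext ?_
    rw [hmul _ _ (by omega) (by omega), hmul _ _ (by omega) (by omega)]
    have h1 := circleMul_cases k i 0
    have h2 := circleMul_cases k i (4 * k)
    omega
  · intro i hi hi'
    have h1 := circleMul_cases k (2 * i - 1) (2 * i)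
    have h2 := circleMul_cases k (2 * i + 1) (2 * i)
    exact ⟨heq _ _ (by omega) (by omega) (by omega), heq _ _ (by omega) (by omega) (by omega)⟩

theorem CutCircle.models_lrb (k : ℕ) : CutCircle.{u} k ⊨ assocLaw.toSentence ∧
    CutCircle.{u} k ⊨ idemLaw.toSentence ∧ CutCircle.{u} k ⊨ leftRegularLaw.toSentence :=
  ⟨realize_assocLaw.2 fun x y z => CutCircle.ext (circleMul_assoc x.le y.le z.le),
    realize_idemLaw.2 fun x => CutCircle.ext (circleMul_self k x.val),
    realize_leftRegularLaw.2 fun _ _ => CutCircle.ext circleMul_leftRegular⟩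

/-! ### Failure of finite axiomatisability -/

/-- Every structure for the language is the magma of its one operation; lifting it to the given
universe preserves sentences. -/
theorem modelsBoundedFormula_of_forall_mul {T : magmaLang.Theory} {φ : magmaLang.Sentence}
    (h : ∀ (S : Type u) [Mul S] [Nonempty S], S ⊨ T → S ⊨ φ) : T ⊨ᵇ φ := by
  refine Language.Theory.models_sentence_iff.2 fun M => ?_
  let : Mul (ULift.{u} M) := ⟨fun a b =>
    ⟨Language.Structure.funMap (L := magmaLang) MagmaFunctions.mul ![a.down, b.down]⟩⟩
  let e : M ≃[magmaLang] ULift.{u} M :=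
    { Equiv.ulift.symm with
      map_fun' := by
        intro n f v
        cases f
        refine congrArg ULift.up (congrArg _ (funext fun i => ?_))
        fin_cases i <;> rfl
      map_rel' := fun r => r.elim }
  have hT : ULift.{u} M ⊨ T := ⟨fun ψ hψ =>
    (Language.StrongHomClass.realize_sentence e ψ).1 (Language.Theory.realize_sentence_of_mem T hψ)⟩
  exact (Language.StrongHomClass.realize_sentence e φ).2 (h _ hT)

/-- A finite subset of the axiom system holds in all sufficiently large cut circles. -/
theorem exists_cutCircle_models (T : Finset magmaLang.Sentence)
    (hT : (T : magmaLang.Theory) ⊆ sigmaL) :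
    ∃ k, 1 ≤ k ∧ CutCircle.{u} k ⊨ (T : magmaLang.Theory) := by
  have h : ∀ φ ∈ T, ∃ K, ∀ k, K ≤ k → CutCircle.{u} k ⊨ φ := by
    intro φ hφ
    rcases hT hφ with (rfl | rfl | rfl) | ⟨n, -, rfl⟩
    · exact ⟨0, fun k _ => (CutCircle.models_lrb k).1⟩
    · exact ⟨0, fun k _ => (CutCircle.models_lrb k).2.1⟩
    · exact ⟨0, fun k _ => (CutCircle.models_lrb k).2.2⟩
    -- From `n + 2` on, both `2 ≤ k` and `n + 1 < 2 * k` hold.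
    · exact ⟨n + 2, fun k hk => CutCircle.models_lam (by omega) (by omega)⟩
  choose! K hK using h
  refine ⟨T.sup K + 1, by omega, ⟨fun φ hφ => hK φ hφ _ ?_⟩⟩
  exact (Finset.le_sup hφ).trans (Nat.le_succ _)

/-- By compactness each sentence of a finite `T` follows from finitely many axioms, so `T` holds in
some cut circle, where another axiom fails. -/
theorem not_exists_finite_theory : ¬ ∃ T : magmaLang.Theory, T.Finite ∧
    ∀ (S : Type u) [Mul S] [Nonempty S], IsRepresentable S ↔ S ⊨ T := by
  classical
  rintro ⟨T, hfin, hT⟩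
  have h : ∀ φ ∈ T, ∃ T₀ : Finset magmaLang.Sentence, (T₀ : magmaLang.Theory) ⊆ sigmaL ∧
      (T₀ : magmaLang.Theory) ⊨ᵇ φ := by
    intro φ hφ
    refine Language.Theory.models_iff_finset_models.1 (modelsBoundedFormula_of_forall_mul.{u} ?_)
    intro S _ _ hS
    exact ((hT S).1 ((isRepresentable_iff_models_sigmaL S).2 hS)).realize_of_mem φ hφ
  choose! T₀ hsub hmod using h
  obtain ⟨k, hk, hmodel⟩ := exists_cutCircle_models.{u} (hfin.toFinset.biUnion T₀) (by
    intro ψ hψ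
    obtain ⟨φ, hφ, hψ⟩ := Finset.mem_biUnion.1 (Finset.mem_coe.1 hψ)
    exact hsub φ (hfin.mem_toFinset.1 hφ) hψ)
  have hTk : CutCircle.{u} k ⊨ T := ⟨fun φ hφ => by
    have : CutCircle.{u} k ⊨ (T₀ φ : magmaLang.Theory) := ⟨fun ψ hψ =>
      hmodel.realize_of_mem ψ (Finset.mem_coe.2
        (Finset.mem_biUnion.2 ⟨φ, hfin.mem_toFinset.2 hφ, hψ⟩))⟩
    exact (hmod φ hφ).realize_sentence _⟩
  have := (isRepresentable_iff_models_sigmaL _).1 ((hT (CutCircle.{u} k)).2 hTk)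
  exact CutCircle.not_models_lam hk (this.realize_of_mem _ (.inr ⟨2 * k - 1, by omega, rfl⟩))

end Override

end

theorem corollary3p1 :
    -- the representable algebras are the semigroups in the quasivariety generated by `L`
    (∀ (S : Type u) [Mul S], Override.IsRepresentable S ↔
      (∀ a b c : S, (a * b) * c = a * (b * c)) ∧ Override.InQuasivarietyOf Override.L S) ∧
    -- the finite ones are the hyperplane face semigroups, up to isomorphism
    (∀ (S : Type u) [Mul S], (Finite S ∧ Override.IsRepresentable S) ↔
      Override.IsHyperplaneFaceSemigroup S) ∧
    -- the axiom system is sound and complete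
    (∀ (S : Type u) [Mul S], Override.IsRepresentable S ↔ S ⊨ Override.sigmaL) ∧
    -- no finite first-order theory axiomatises the class
    ¬ ∃ T : Override.magmaLang.Theory, T.Finite ∧
      ∀ (S : Type u) [Mul S] [Nonempty S], Override.IsRepresentable S ↔ S ⊨ T := by
  exact ⟨Override.isRepresentable_iff_inQuasivarietyOf, Override.finite_and_isRepresentable_iff,
    Override.isRepresentable_iff_models_sigmaL, Override.not_exists_finite_theory⟩
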